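/- Fix the following branches of powers. For $w\in\mathbb C\setminus[0,\infty)$ and $a>0$ put $w^{a}=e^{a\log_{(1)}w}$ with $\operatorname{Im}\log_{(1)}w\in(0,2\pi)$; this branch is used for the powers with exponents $\alpha$ and $1/\alpha$ of complex numbers. For $w\in\mathbb C\setminus(-\infty,0]$ put $w^{1/r}=e^{\frac1r\log_{(2)}w}$ with $\operatorname{Im}\log_{(2)}w\in(-\pi,\pi)$; this branch is used for the powers with exponent $1/r$. Let $\mathbb C_+=\{z\in\mathbb C:\operatorname{Im}z>0\}$. Suppose $1\le r<\infty$, $0<\alpha\le2$ and $s\in\mathbb C\setminus\{0\}$, and assume that $(\alpha,s)$ is admissible, that is, with $\arg s\in(-\pi,\pi]$, either (1) $0<\alpha\le1$ and $(1-\alpha)\pi\le\arg s\le\pi$, or (2) $1<\alpha\le2$ and $0\le\arg s\le(2-\alpha)\pi$. Then the function $$G^\alpha_{s,r}(z)=-r^{1/\alpha}\left(\frac{1-\big(1-s(-\tfrac1z)^\alpha\big)^{1/r}}{s}\right)^{1/\alpha}$$ where $r^{1/\alpha}>0$, is well defined for every $z\in\mathbb C_+$ (each complex power is evaluated in the domain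 of its branch: $1-s(-\frac1z)^\alpha\notin(-\infty,0]$ and $\big(1-(1-s(-\frac1z)^\alpha)^{1/r}\big)/s\notin[0,\infty)$), and there is a Borel probability measure $\mu^\alpha_{s,r}$ on $\mathbb R$ of which it is the Cauchy transform: $$G^\alpha_{s,r}(z)=\int_{\mathbb R}\frac{\mu^\alpha_{s,r}(dx)}{z-x}\qquad(z\in\mathbb C_+).$$ Moreover, $G^\alpha_{s,r}$ is univalent (holomorphic and injective) in $\mathbb C_+$. -/

import Mathlib

noncomputable section

namespace CauchyPowers

/-- The domain `ℂ \ [0, ∞)`. -/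
def cutPlane : Set ℂ := {z | z.re < 0 ∨ z.im ≠ 0}

/-- The branch of the logarithm on `ℂ \ [0, ∞)` with imaginary part in `(0, 2π)`. -/
def logOne (z : ℂ) : ℂ := Complex.log (-z) + Real.pi * Complex.I

theorem exp_logOne {z : ℂ} (hz : z ≠ 0) : Complex.exp (logOne z) = z := by
  rw [logOne, Complex.exp_add, Complex.exp_log (neg_ne_zero.mpr hz), Complex.exp_pi_mul_I]
  ring

theorem logOne_im_mem {z : ℂ} (hz : z ∈ cutPlane) :
    (logOne z).im ∈ Set.Ioo 0 (2 * Real.pi) := by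
  have h : -z ∈ Complex.slitPlane := by
    rw [Complex.mem_slitPlane_iff]
    rcases hz with h | h
    · left; simpa using h
    · right; simpa using h
  have h1 := Complex.neg_pi_lt_arg (-z)
  have h2 := (Complex.arg_le_pi (-z)).lt_of_ne (Complex.mem_slitPlane_iff_arg.mp h).1
  constructor <;> simp [logOne, Complex.log_im] <;> linarith

/-- The power `z ^ a = exp (a log z)` on `ℂ \ [0, ∞)`, with `Im log z ∈ (0, 2π)`. -/
def powOne (z : ℂ) (a : ℝ) : ℂ := Complex.exp (a * logOne z)

/-- The power `z ^ a = exp (a log z)` on `ℂ \ (-∞, 0]`, with `Im log z ∈ (-π, π)`. -/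
def powTwo (z : ℂ) (a : ℝ) : ℂ := Complex.exp (a * Complex.log z)

/-- `1 - s (-1/z) ^ α`. -/
def innerFun (α : ℝ) (s z : ℂ) : ℂ := 1 - s * powOne (-1 / z) α

/-- `(1 - (1 - s (-1/z) ^ α) ^ (1/r)) / s`. -/
def outerFun (α r : ℝ) (s z : ℂ) : ℂ := (1 - powTwo (innerFun α s z) (1 / r)) / s

/-- `G(z) = - r ^ (1/α) * ((1 - (1 - s (-1/z) ^ α) ^ (1/r)) / s) ^ (1/α)`. -/
def G (α r : ℝ) (s z : ℂ) : ℂ :=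
  -((r ^ (1 / α) : ℝ) : ℂ) * powOne (outerFun α r s z) (1 / α)

/-- Each power in the formula for `G` is evaluated at a point of the domain of its branch. -/
def WellDefinedAt (α r : ℝ) (s z : ℂ) : Prop :=
  -1 / z ∈ cutPlane ∧ innerFun α s z ∈ Complex.slitPlane ∧ outerFun α r s z ∈ cutPlane

/-- The admissible pairs `(α, s)`. -/
def Admissible (α : ℝ) (s : ℂ) : Prop :=
  (0 < α ∧ α ≤ 1 ∧ (1 - α) * Real.pi ≤ s.arg ∧ s.arg ≤ Real.pi) ∨
  (1 < α ∧ α ≤ 2 ∧ 0 ≤ s.arg ∧ s.arg ≤ (2 - α) * Real.pi)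

/-- The Cauchy transform `G_μ(z) = ∫ μ(dx) / (z - x)`. -/
def cauchyTransform (μ : MeasureTheory.Measure ℝ) (z : ℂ) : ℂ := ∫ x : ℝ, 1 / (z - (x : ℂ)) ∂μ

/-- Univalent on an open set `U`: holomorphic and injective there. -/
def UnivalentOn (f : ℂ → ℂ) (U : Set ℂ) : Prop := DifferentiableOn ℂ f U ∧ Set.InjOn f U

end CauchyPowers

end

/-!
Write `t = 1/r`, `-1/z = exp L` with `Im L ∈ (0, π)`, `u = s (-1/z) ^ α` and `v = 1 - (1 - u) ^ t`, so
that `G(z) = -r ^ (1/α) (v/s) ^ (1/α)`.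

*Sectors.* Admissibility of `(α, s)` means `0 ≤ arg s ≤ π ≤ arg s + α π ≤ 2π` (`Admissible.sector`), so
`u` lies in the sector `arg s < θ < arg s + α π`, which avoids `[0, ∞)`. The point is that
`u ↦ v` maps this sector to itself, since it moves the argument towards `π` (`arg_powQuot_exp`). For
`Im u > 0` this says `Im (v/u) ≥ 0`, and in polar coordinates of `1 - u` it is the inequality
`ρ ^ (1 - t) sin φ ≤ sin (t φ) + ρ sin ((1 - t) φ)` (`rpow_mul_sin_le`), which follows from concavity
of the sine and weighted AM-GM. Hence the argument of `v/s` is in `(0, α π)`; all powers are evaluated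
in their domains, `Im G < 0` (`G_im_neg`), and `G` is a composition of exponentials, each
injective on the relevant strip (`injOn_G`).

*Behaviour at infinity.* No logarithm jumps, so `z G(z) = r ^ (1/α) exp (log (v/u) / α)` (`mul_G_eq`),
and `v/u → 1/r` as `u → 0`. Therefore `z G(z) → 1` as `z → ∞` in the upper half-plane.

*Representation.* A holomorphic map from the upper half-plane to the closed lower one with
`z F(z) → 1` is the Cauchy transform of a probability measure (`exists_eq_cauchyTransform`). For the shifts
`F(· + iε)` Cauchy's formula on the half-plane gives the density `-Im F(x + iε) / π`; the behaviour of
`z F(z)` gives mass one and tightness, and Prokhorov's theorem gives a limit as `ε → 0`.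
-/

namespace CauchyPowers

open Complex MeasureTheory Filter Topology Set Bornology Asymptotics
open scoped ComplexConjugate

/-! ### Cauchy's formula on the upper half-plane -/

theorem tendsto_ofReal_cocompact_halfPlane :
    Tendsto (fun x : ℝ => (x : ℂ)) (cocompact ℝ) (cobounded ℂ ⊓ 𝓟 {z | 0 ≤ z.im}) := by
  refine tendsto_inf.2 ⟨?_, tendsto_principal.2 (Eventually.of_forall fun x => by simp)⟩
  rw [← Metric.cobounded_eq_cocompact, ← tendsto_norm_atTop_iff_cobounded]
  exact (tendsto_norm_cobounded_atTop (E := ℝ)).congr fun x => (norm_real x).symm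

theorem isBigO_inv_sub_inv (w : ℂ) :
    (fun z : ℂ => (z - w)⁻¹) =O[cobounded ℂ] fun z => z⁻¹ := by
  refine IsBigO.of_bound 2 ?_
  have : ∀ᶠ z : ℂ in cobounded ℂ, 2 * ‖w‖ + 1 ≤ ‖z‖ :=
    tendsto_norm_cobounded_atTop.eventually_ge_atTop _
  filter_upwards [this] with z hz
  have h1 : ‖z‖ - ‖w‖ ≤ ‖z - w‖ := norm_sub_norm_le z w
  have h0 := norm_nonneg w
  rw [norm_inv, norm_inv, ← div_eq_mul_inv, inv_eq_one_div,
    div_le_div_iff₀ (by linarith) (by linarith)]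
  linarith

theorem integrable_of_isBigO_inv_sq {h : ℝ → ℂ} (hc : Continuous h)
    (hb : h =O[cocompact ℝ] fun x => (x : ℂ)⁻¹ * (x : ℂ)⁻¹) : Integrable h := by
  have h1 : (fun x : ℝ => (x : ℂ)⁻¹ * (x : ℂ)⁻¹) =O[cocompact ℝ] fun x : ℝ => (1 + x ^ 2)⁻¹ := by
    refine IsBigO.of_bound 2 ?_
    have : ∀ᶠ x : ℝ in cocompact ℝ, 1 ≤ ‖x‖ := by
      rw [← Metric.cobounded_eq_cocompact]
      exact tendsto_norm_cobounded_atTop.eventually_ge_atTop _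
    filter_upwards [this] with x hx
    have hx2 : 1 ≤ x ^ 2 := by rw [← sq_abs]; rw [Real.norm_eq_abs] at hx; nlinarith
    rw [← mul_inv, norm_inv, norm_mul, norm_real, Real.norm_eq_abs, Real.norm_eq_abs,
      abs_mul_abs_self, abs_of_pos (by positivity), inv_eq_one_div, ← div_eq_mul_inv,
      div_le_div_iff₀ (by nlinarith) (by positivity)]
    nlinarith
  exact hc.locallyIntegrable.integrable_of_isBigO_cocompact (hb.trans h1)
    (integrable_inv_one_add_sq.integrableAtFilter _)

/-- Cauchy-Goursat for the upper half-plane: with decay `O(z⁻²)`, the sides of the rectangles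
`[-R, R] × [0, R]` off the real axis contribute `O(R⁻¹)`. -/
theorem integral_ofReal_eq_zero_of_halfPlane {h : ℂ → ℂ}
    (hc : ContinuousOn h {z | 0 ≤ z.im}) (hd : DifferentiableOn ℂ h {z | 0 < z.im})
    (hb : h =O[cobounded ℂ ⊓ 𝓟 {z | 0 ≤ z.im}] fun z => z⁻¹ * z⁻¹) :
    ∫ x : ℝ, h x = 0 := by
  have hcR : Continuous fun x : ℝ => h x :=
    hc.comp_continuous continuous_ofReal fun x => by simp
  have hint : Integrable fun x : ℝ => h x :=
    integrable_of_isBigO_inv_sq hcR (hb.comp_tendsto tendsto_ofReal_cocompact_halfPlane)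
  obtain ⟨C, hC0, hC⟩ := hb.exists_pos
  rw [isBigOWith_iff, eventually_inf_principal,
    (hasBasis_cobounded_norm).eventually_iff] at hC
  obtain ⟨R₀, -, hC⟩ := hC
  have hlim := intervalIntegral_tendsto_integral hint tendsto_neg_atTop_atBot tendsto_id
  have hzero : Tendsto (fun R : ℝ => ∫ x in (-R)..R, h x) atTop (𝓝 0) := by
    refine squeeze_zero_norm' (a := fun R : ℝ => 4 * C * R⁻¹) ?_
      (by simpa using tendsto_inv_atTop_zero.const_mul (4 * C))
    filter_upwards [eventually_ge_atTop R₀, eventually_gt_atTop 0] with R hR hR0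
    have hbound : ∀ z : ℂ, 0 ≤ z.im → R ≤ ‖z‖ → ‖h z‖ ≤ C * (R⁻¹ * R⁻¹) := by
      intro z hz hzR
      refine (hC (hR.trans hzR) hz).trans ?_
      rw [norm_mul, norm_inv]
      gcongr
    have hrect := integral_boundary_rect_eq_zero_of_continuousOn_of_differentiableOn h
      ((-R : ℝ) : ℂ) ((R : ℝ) + (R : ℝ) * I)
      (hc.mono fun z hz => by
        have := hz.2
        simp only [mem_preimage, ofReal_im, add_im, mul_im, I_im, ofReal_re, I_re] at this
        rw [uIcc_of_le (by linarith)] at this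
        exact this.1)
      (hd.mono fun z hz => by
        have := hz.2
        simp only [mem_preimage, ofReal_im, add_im, mul_im, I_im, ofReal_re, I_re] at this
        rw [min_eq_left (by linarith)] at this
        exact this.1)
    simp only [ofReal_im, ofReal_re, add_im, add_re, mul_im, mul_re, I_im, I_re, mul_one, mul_zero,
      sub_zero, add_zero, zero_add, ofReal_zero, zero_mul, smul_eq_mul] at hrect
    have h1 : ‖∫ x : ℝ in (-R)..R, h (x + R * I)‖ ≤ C * (R⁻¹ * R⁻¹) * |R - -R| := by
      refine intervalIntegral.norm_integral_le_of_norm_le_const fun x _ => hbound _ ?_ ?_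
      · simpa using hR0.le
      · simpa [abs_of_pos hR0] using abs_im_le_norm ((x : ℂ) + R * I)
    have h2 : ‖∫ y : ℝ in (0 : ℝ)..R, h (R + y * I)‖ ≤ C * (R⁻¹ * R⁻¹) * |R - 0| := by
      refine intervalIntegral.norm_integral_le_of_norm_le_const fun y hy => hbound _ ?_ ?_
      · rw [uIoc_of_le hR0.le] at hy
        simpa using hy.1.le
      · simpa [abs_of_pos hR0] using abs_re_le_norm ((R : ℂ) + y * I)
    have h3 : ‖∫ y : ℝ in (0 : ℝ)..R, h ((-R : ℝ) + y * I)‖ ≤ C * (R⁻¹ * R⁻¹) * |R - 0| := by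
      refine intervalIntegral.norm_integral_le_of_norm_le_const fun y hy => hbound _ ?_ ?_
      · rw [uIoc_of_le hR0.le] at hy
        simpa using hy.1.le
      · simpa [abs_of_pos hR0] using abs_re_le_norm (((-R : ℝ) : ℂ) + y * I)
    have h4 : ∫ x : ℝ in (-R)..R, h x = (∫ x : ℝ in (-R)..R, h (x + R * I))
        - I * (∫ y : ℝ in (0 : ℝ)..R, h (R + y * I))
        + I * (∫ y : ℝ in (0 : ℝ)..R, h ((-R : ℝ) + y * I)) := by
      linear_combination hrect
    rw [h4]
    refine (norm_add_le _ _).trans ((add_le_add (norm_sub_le _ _) le_rfl).trans ?_)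
    rw [norm_mul, norm_mul, norm_I, one_mul, one_mul]
    refine (add_le_add (add_le_add h1 h2) h3).trans (le_of_eq ?_)
    rw [sub_zero, abs_of_pos hR0, abs_of_pos (by linarith)]
    field_simp
    ring
  exact tendsto_nhds_unique hlim hzero

theorem integrable_ofReal_mul_inv_sub {F : ℂ → ℂ} (hc : ContinuousOn F {z | 0 ≤ z.im})
    (hb : F =O[cobounded ℂ ⊓ 𝓟 {z | 0 ≤ z.im}] fun z => z⁻¹) {w : ℂ} (hw : w.im ≠ 0) :
    Integrable fun x : ℝ => F x * ((x : ℂ) - w)⁻¹ := by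
  have hxc : Continuous fun x : ℝ => ((x : ℂ) - w)⁻¹ :=
    (continuous_ofReal.sub continuous_const).inv₀ fun x => sub_ne_zero.2 fun h => hw (by simp [← h])
  exact integrable_of_isBigO_inv_sq
      ((hc.comp_continuous continuous_ofReal fun x => by simp).mul hxc)
      ((hb.mul ((isBigO_inv_sub_inv w).mono inf_le_left)).comp_tendsto
        tendsto_ofReal_cocompact_halfPlane)

theorem integral_div_sub_eq_zero {F : ℂ → ℂ} (hc : ContinuousOn F {z | 0 ≤ z.im})
    (hd : DifferentiableOn ℂ F {z | 0 < z.im})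
    (hb : F =O[cobounded ℂ ⊓ 𝓟 {z | 0 ≤ z.im}] fun z => z⁻¹) {w : ℂ} (hw : w.im < 0) :
    ∫ x : ℝ, F x * ((x : ℂ) - w)⁻¹ = 0 := by
  have hne : ∀ z : ℂ, 0 ≤ z.im → z - w ≠ 0 := fun z hz h => by
    have : z = w := sub_eq_zero.1 h
    rw [this] at hz; linarith
  refine integral_ofReal_eq_zero_of_halfPlane (h := fun z => F z * (z - w)⁻¹) ?_ ?_ ?_
  · exact hc.mul ((continuousOn_id.sub continuousOn_const).inv₀ hne)
  · exact hd.mul ((differentiableOn_id.sub_const w).inv fun z hz => hne z (le_of_lt hz))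
  · exact hb.mul ((isBigO_inv_sub_inv w).mono inf_le_left)

/-- The integrand is `2πi` times the Poisson kernel of the upper half-plane. -/
theorem integral_inv_sub_sub_inv_sub_conj {z : ℂ} (hz : 0 < z.im) :
    ∫ x : ℝ, (z - conj z) * ((x : ℂ) - conj z)⁻¹ * ((x : ℂ) - z)⁻¹ = 2 * Real.pi * I := by
  have h1 : ∀ x : ℝ, (z - conj z) * ((x : ℂ) - conj z)⁻¹ * ((x : ℂ) - z)⁻¹
      = ((z.im⁻¹ * (1 + ((x - z.re) / z.im) ^ 2)⁻¹ : ℝ) : ℂ) * (2 * I) := by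
    intro x
    have e1 : z - conj z = 2 * z.im * I := by
      apply Complex.ext <;> simp; ring
    have e2 : ((x : ℂ) - conj z) * ((x : ℂ) - z) = (((x - z.re) ^ 2 + z.im ^ 2 : ℝ) : ℂ) := by
      apply Complex.ext <;> simp [-ofReal_add, -ofReal_pow, -ofReal_sub] <;> ring
    have e3 : z.im⁻¹ * (1 + ((x - z.re) / z.im) ^ 2)⁻¹ = z.im / ((x - z.re) ^ 2 + z.im ^ 2) := by
      have : (x - z.re) ^ 2 + z.im ^ 2 ≠ 0 := by positivity
      have h3 : 1 + ((x - z.re) / z.im) ^ 2 = ((x - z.re) ^ 2 + z.im ^ 2) / z.im ^ 2 := by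
        field_simp; ring
      rw [h3]; field_simp
    rw [mul_assoc, ← mul_inv, e1, e2, e3]
    push_cast
    ring
  simp_rw [h1]
  rw [integral_mul_const, integral_complex_ofReal, integral_const_mul]
  have h2 : ∫ x : ℝ, (1 + ((x - z.re) / z.im) ^ 2)⁻¹ = z.im * Real.pi := by
    rw [integral_sub_right_eq_self (fun x : ℝ => (1 + (x / z.im) ^ 2)⁻¹) z.re,
      Measure.integral_comp_div (fun x : ℝ => (1 + x ^ 2)⁻¹) z.im, integral_univ_inv_one_add_sq,
      abs_of_pos hz, smul_eq_mul]
  rw [h2, inv_mul_cancel_left₀ hz.ne']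
  ring

/-- Cauchy's integral formula for the upper half-plane. Subtracting from `F` the multiple of
`z ↦ (w - conj w) / (z - conj w)` that agrees with it at `w` removes the pole at `w` without spoiling
the decay, and the integral of the subtracted kernel is explicit. -/
theorem integral_div_sub_eq {F : ℂ → ℂ} (hc : ContinuousOn F {z | 0 ≤ z.im})
    (hd : DifferentiableOn ℂ F {z | 0 < z.im})
    (hb : F =O[cobounded ℂ ⊓ 𝓟 {z | 0 ≤ z.im}] fun z => z⁻¹) {w : ℂ} (hw : 0 < w.im) :
    ∫ x : ℝ, F x * ((x : ℂ) - w)⁻¹ = 2 * Real.pi * I * F w := by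
  have hne : ∀ z : ℂ, 0 ≤ z.im → z - conj w ≠ 0 := fun z hz h => by
    have : z = conj w := sub_eq_zero.1 h
    rw [this, conj_im] at hz; linarith
  have hxw : ∀ x : ℝ, (x : ℂ) ≠ w := fun x h => by
    rw [← h] at hw; simp at hw
  set k : ℂ → ℂ := fun z => F w * ((w - conj w) * (z - conj w)⁻¹) with hk
  have hkw : k w = F w := by
    simp only [hk]
    rw [mul_inv_cancel₀ (hne w hw.le), mul_one]
  have hopen : IsOpen {z : ℂ | 0 < z.im} := isOpen_lt continuous_const continuous_im
  have hmem : {z : ℂ | 0 < z.im} ∈ 𝓝 w := hopen.mem_nhds hw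
  have hkc : ContinuousOn k {z | 0 ≤ z.im} :=
    continuousOn_const.mul (continuousOn_const.mul
      ((continuousOn_id.sub continuousOn_const).inv₀ hne))
  have hkd : DifferentiableOn ℂ k {z | 0 < z.im} :=
    (((differentiableOn_id.sub_const _).inv fun z hz => hne z (le_of_lt hz)).const_mul _).const_mul _
  have hkb : k =O[cobounded ℂ ⊓ 𝓟 {z | 0 ≤ z.im}] fun z => z⁻¹ :=
    (((isBigO_inv_sub_inv (conj w)).mono inf_le_left).const_mul_left _).const_mul_left _
  have hds : ∀ z, z ≠ w →
      dslope (fun z => F z - k z) w z = (F z - k z) * (z - w)⁻¹ := fun z hz => by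
    rw [dslope_of_ne _ hz, slope_def_field, hkw, sub_self, sub_zero, div_eq_mul_inv]
  have key : ∫ x : ℝ, dslope (fun z => F z - k z) w x = 0 := by
    refine integral_ofReal_eq_zero_of_halfPlane ?_ ?_ ?_
    · refine (continuousOn_dslope (mem_of_superset hmem fun z (hz : 0 < z.im) => hz.le)).2
        ⟨hc.sub hkc, ((hd.sub hkd).differentiableAt hmem)⟩
    · exact (Complex.differentiableOn_dslope hmem).2 (hd.sub hkd)
    · refine ((hb.sub hkb).mul ((isBigO_inv_sub_inv w).mono inf_le_left)).congr' ?_ .rfl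
      have : ∀ᶠ z : ℂ in cobounded ℂ ⊓ 𝓟 {z | 0 ≤ z.im}, z ≠ w :=
        (eventually_ne_cobounded w).filter_mono inf_le_left
      filter_upwards [this] with z hz using (hds z hz).symm
  have hsplit : ∀ x : ℝ, dslope (fun z => F z - k z) w x
      = F x * ((x : ℂ) - w)⁻¹ - k x * ((x : ℂ) - w)⁻¹ := fun x => by
    rw [hds x (hxw x), sub_mul]
  simp_rw [hsplit] at key
  rw [integral_sub (integrable_ofReal_mul_inv_sub hc hb hw.ne')
    (integrable_ofReal_mul_inv_sub hkc hkb hw.ne'), sub_eq_zero] at key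
  rw [key]
  simp only [hk]
  simp_rw [mul_assoc (F w)]
  rw [integral_const_mul, integral_inv_sub_sub_inv_sub_conj hw, mul_comm]

/-! ### Representation by Cauchy transforms -/

/-- A function continuous up to the real axis with decay `O(z⁻¹)` is the Cauchy transform of the
density `-Im F / π`. This combines Cauchy's formula at `w` with the conjugate of the vanishing integral
at `conj w`. -/
theorem eq_integral_neg_im_mul_inv_sub {F : ℂ → ℂ} (hc : ContinuousOn F {z | 0 ≤ z.im})
    (hd : DifferentiableOn ℂ F {z | 0 < z.im})
    (hb : F =O[cobounded ℂ ⊓ 𝓟 {z | 0 ≤ z.im}] fun z => z⁻¹) {w : ℂ} (hw : 0 < w.im) :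
    Integrable (fun x : ℝ => ((-(F x).im / Real.pi : ℝ) : ℂ) * (w - x)⁻¹) ∧
      ∫ x : ℝ, ((-(F x).im / Real.pi : ℝ) : ℂ) * (w - x)⁻¹ = F w := by
  have hwc : (conj w).im < 0 := by simpa using hw
  have hA := integral_div_sub_eq hc hd hb hw
  have hB : ∫ x : ℝ, conj (F x * ((x : ℂ) - conj w)⁻¹) = 0 := by
    rw [integral_conj, integral_div_sub_eq_zero hc hd hb hwc, map_zero]
  have hAi := integrable_ofReal_mul_inv_sub hc hb hw.ne'
  have hBi : Integrable fun x : ℝ => conj (F x * ((x : ℂ) - conj w)⁻¹) :=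
    conjCLE.toContinuousLinearMap.integrable_comp (integrable_ofReal_mul_inv_sub hc hb hwc.ne)
  have hpi : (Real.pi : ℂ) ≠ 0 := ofReal_ne_zero.2 Real.pi_ne_zero
  have hx : ∀ x : ℝ, ((-(F x).im / Real.pi : ℝ) : ℂ) * (w - x)⁻¹
      = (2 * Real.pi * I)⁻¹ *
        (F x * ((x : ℂ) - w)⁻¹ - conj (F x * ((x : ℂ) - conj w)⁻¹)) := by
    intro x
    have e : F x - conj (F x) = 2 * (F x).im * I := by
      apply Complex.ext <;> simp; ring
    have hn : (w - x)⁻¹ = -((x : ℂ) - w)⁻¹ := by rw [← inv_neg, neg_sub]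
    rw [map_mul, map_inv₀, map_sub, conj_ofReal, conj_conj, ← sub_mul, e, hn]
    push_cast
    field_simp
  simp_rw [hx]
  refine ⟨(hAi.sub hBi).const_mul _, ?_⟩
  rw [integral_const_mul, integral_sub hAi hBi, hA, hB, sub_zero,
    inv_mul_cancel_left₀ (by simp [hpi])]

theorem isBigO_inv_of_tendsto_mul {F : ℂ → ℂ} {S : Set ℂ}
    (h : Tendsto (fun z => z * F z) (cobounded ℂ ⊓ 𝓟 S) (𝓝 1)) :
    F =O[cobounded ℂ ⊓ 𝓟 S] fun z => z⁻¹ := by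
  have h1 := (h.isBigO_one ℂ).mul (isBigO_refl (fun z : ℂ => z⁻¹) _)
  refine h1.congr' ?_ (by simp)
  filter_upwards [(eventually_ne_cobounded (0 : ℂ)).filter_mono inf_le_left] with z hz
  field_simp

theorem tendsto_I_mul_cobounded {S : Set ℂ} (hS : ∀ z : ℂ, 0 < z.im → z ∈ S) :
    Tendsto (fun y : ℝ => (y : ℂ) * I) atTop (cobounded ℂ ⊓ 𝓟 S) := by
  refine tendsto_inf.2 ⟨?_, tendsto_principal.2 ?_⟩
  · rw [← tendsto_norm_atTop_iff_cobounded]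
    refine tendsto_abs_atTop_atTop.congr fun y => by simp
  · filter_upwards [eventually_gt_atTop 0] with y hy
    exact hS _ (by simpa using hy)

theorem im_ofReal_mul_I (y : ℝ) : ((y : ℂ) * I).im = y := by simp

theorem re_mul_I_mul_inv_sub (y x : ℝ) :
    ((y : ℂ) * I * ((y : ℂ) * I - x)⁻¹).re = y ^ 2 / (x ^ 2 + y ^ 2) := by
  simp [normSq_apply]
  ring

/-- Nevanlinna representation for functions continuous up to the real axis. The normalisation
`z F(z) → 1` at infinity makes `-Im F / π` a probability density. -/
theorem exists_eq_cauchyTransform_of_continuousOn {F : ℂ → ℂ}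
    (hc : ContinuousOn F {z | 0 ≤ z.im})
    (hd : DifferentiableOn ℂ F {z | 0 < z.im})
    (him : ∀ x : ℝ, (F x).im ≤ 0)
    (hlim : Tendsto (fun z => z * F z) (cobounded ℂ ⊓ 𝓟 {z | 0 ≤ z.im}) (𝓝 1)) :
    ∃ μ : ProbabilityMeasure ℝ, ∀ z : ℂ, 0 < z.im → F z = cauchyTransform μ z := by
  set ρ : ℝ → ℝ := fun x => -(F x).im / Real.pi
  have hρ0 : ∀ x, 0 ≤ ρ x := fun x => div_nonneg (neg_nonneg.2 (him x)) Real.pi_pos.le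
  have hρc : Continuous ρ :=
    (continuous_im.comp (hc.comp_continuous continuous_ofReal fun x => by simp)).neg.div_const _
  have hrep : ∀ w : ℂ, 0 < w.im → Integrable (fun x : ℝ => (ρ x : ℂ) * (w - x)⁻¹) ∧
      ∫ x : ℝ, (ρ x : ℂ) * (w - x)⁻¹ = F w := fun w hw =>
    eq_integral_neg_im_mul_inv_sub hc hd (isBigO_inv_of_tendsto_mul hlim) hw
  have hmass : ∫⁻ x, ENNReal.ofReal (ρ x) = 1 := by
    -- Monotone convergence for `y² / (x² + y²) ↑ 1` along `y = n + 1`; the integral against `ρ` is the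
    -- real part of `iy F(iy)`, which tends to one.
    have hmono := lintegral_tendsto_of_tendsto_of_monotone (μ := volume)
      (f := fun (n : ℕ) (x : ℝ) =>
        ENNReal.ofReal (ρ x * (((n : ℝ) + 1) ^ 2 / (x ^ 2 + ((n : ℝ) + 1) ^ 2))))
      (F := fun x => ENNReal.ofReal (ρ x)) (fun n => by
        refine (ENNReal.continuous_ofReal.comp (hρc.mul ?_)).aemeasurable
        exact continuous_const.div (by fun_prop) fun x => by positivity)
      (ae_of_all _ fun x m n hmn => by
        have hmn' : (m : ℝ) ≤ n := by exact_mod_cast hmn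
        refine ENNReal.ofReal_le_ofReal (mul_le_mul_of_nonneg_left ?_ (hρ0 x))
        rw [div_le_div_iff₀ (by positivity) (by positivity)]
        have : ((m : ℝ) + 1) ^ 2 ≤ ((n : ℝ) + 1) ^ 2 := by gcongr
        nlinarith [sq_nonneg x])
      (ae_of_all _ fun x => by
        refine ENNReal.tendsto_ofReal ?_
        have h1 : Tendsto (fun n : ℕ => 1 - x ^ 2 * (x ^ 2 + ((n : ℝ) + 1) ^ 2)⁻¹) atTop (𝓝 1) := by
          have h2 : Tendsto (fun n : ℕ => x ^ 2 + ((n : ℝ) + 1) ^ 2) atTop atTop :=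
            tendsto_atTop_add_const_left _ _ ((tendsto_pow_atTop two_ne_zero).comp
              (tendsto_atTop_add_const_right _ _ tendsto_natCast_atTop_atTop))
          simpa using (h2.inv_tendsto_atTop.const_mul (x ^ 2)).const_sub 1
        have h3 := h1.const_mul (ρ x)
        rw [mul_one] at h3
        refine h3.congr fun n => ?_
        have : x ^ 2 + ((n : ℝ) + 1) ^ 2 ≠ 0 := by positivity
        field_simp
        ring)
    have hval : ∀ n : ℕ, ∫⁻ x, ENNReal.ofReal
        (ρ x * (((n : ℝ) + 1) ^ 2 / (x ^ 2 + ((n : ℝ) + 1) ^ 2)))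
        = ENNReal.ofReal ((((n + 1 : ℝ) : ℂ) * I * F (((n + 1 : ℝ) : ℂ) * I)).re) := by
      intro n
      have him1 : 0 < (((n + 1 : ℝ) : ℂ) * I).im := by
        rw [im_ofReal_mul_I]; positivity
      obtain ⟨hi, he⟩ := hrep _ him1
      have hi2 := hi.const_mul (((n + 1 : ℝ) : ℂ) * I)
      have hxe : ∀ x : ℝ, (((n + 1 : ℝ) : ℂ) * I *
          ((ρ x : ℂ) * (((n + 1 : ℝ) : ℂ) * I - x)⁻¹)).re
          = ρ x * (((n : ℝ) + 1) ^ 2 / (x ^ 2 + ((n : ℝ) + 1) ^ 2)) := fun x => by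
        rw [mul_left_comm, re_ofReal_mul, re_mul_I_mul_inv_sub]
      have hre := integral_re (𝕜 := ℂ) hi2
      have hire := hi2.re
      simp only [RCLike.re_to_complex] at hre hire
      rw [integral_const_mul, he] at hre
      rw [← hre]
      simp_rw [hxe] at hire ⊢
      rw [ofReal_integral_eq_lintegral_ofReal hire
        (ae_of_all _ fun x => mul_nonneg (hρ0 x) (by positivity))]
    simp_rw [hval] at hmono
    refine tendsto_nhds_unique hmono ?_
    have h1 := (hlim.comp (tendsto_I_mul_cobounded fun z hz => le_of_lt hz)).comp
      (tendsto_atTop_add_const_right atTop (1 : ℝ) tendsto_natCast_atTop_atTop)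
    have h2 := ENNReal.tendsto_ofReal ((continuous_re.tendsto _).comp h1)
    simpa [Function.comp_def] using h2
  refine ⟨⟨volume.withDensity fun x => ENNReal.ofReal (ρ x), ⟨by
    rw [withDensity_apply _ MeasurableSet.univ, Measure.restrict_univ, hmass]⟩⟩, fun z hz => ?_⟩
  rw [cauchyTransform, ProbabilityMeasure.coe_mk,
    integral_withDensity_eq_integral_toReal_smul (by fun_prop) (by simp)]
  rw [← (hrep z hz).2]
  refine integral_congr_ae (ae_of_all _ fun x => ?_)
  simp only
  rw [ENNReal.toReal_ofReal (hρ0 x), real_smul, one_div]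

theorem continuous_one_div_sub {z : ℂ} (hz : 0 < z.im) :
    Continuous fun x : ℝ => 1 / (z - (x : ℂ)) :=
  continuous_const.div (continuous_const.sub continuous_ofReal) fun x h => by
    have : z = x := sub_eq_zero.1 h
    simp [this] at hz

theorem norm_one_div_sub_le {z : ℂ} (hz : 0 < z.im) (x : ℝ) :
    ‖1 / (z - (x : ℂ))‖ ≤ z.im⁻¹ := by
  rw [norm_div, norm_one, one_div]
  refine inv_anti₀ hz ?_
  have := abs_im_le_norm (z - (x : ℂ))
  simpa [abs_of_pos hz] using this

/-- Tail bound through the Cauchy transform, from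
`1 - Re (iy G(iy)) = ∫ x² / (x² + y²) dμ`, where the integrand is at least `1/2` for `|x| > y`. -/
theorem measureReal_compl_Icc_le (μ : Measure ℝ) [IsProbabilityMeasure μ] {y : ℝ} (hy : 0 < y) :
    μ.real (Icc (-y) y)ᶜ ≤ 2 * (1 - ((y : ℂ) * I * cauchyTransform μ ((y : ℂ) * I)).re) := by
  have him : 0 < ((y : ℂ) * I).im := by simpa using hy
  have hi : Integrable (fun x : ℝ => (y : ℂ) * I * (1 / ((y : ℂ) * I - x))) μ :=
    (Integrable.of_bound (continuous_one_div_sub him).aestronglyMeasurable _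
      (ae_of_all _ (norm_one_div_sub_le him))).const_mul _
  have hre := integral_re (𝕜 := ℂ) hi
  have hire := hi.re
  simp only [RCLike.re_to_complex, one_div, re_mul_I_mul_inv_sub] at hre hire
  rw [integral_const_mul] at hre
  simp only [cauchyTransform, one_div]
  rw [← hre]
  have h1 : (1 : ℝ) = ∫ _ : ℝ, (1 : ℝ) ∂μ := by simp
  rw [← integral_indicator_one measurableSet_Icc.compl, h1, ← integral_sub (integrable_const _) hire,
    ← integral_const_mul]
  refine integral_mono ((integrable_const _).indicator measurableSet_Icc.compl)
    (((integrable_const _).sub hire).const_mul 2) fun x => ?_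
  have hpos : 0 < x ^ 2 + y ^ 2 := by positivity
  have hle : y ^ 2 / (x ^ 2 + y ^ 2) ≤ 1 := (div_le_one hpos).2 (by nlinarith [sq_nonneg x])
  by_cases hx : x ∈ (Icc (-y) y)ᶜ
  · rw [indicator_of_mem hx]
    have hxy : y ^ 2 ≤ x ^ 2 := by
      rw [sq_le_sq, abs_of_pos hy]
      by_contra! hcon
      exact hx ⟨(abs_lt.1 hcon).1.le, (abs_lt.1 hcon).2.le⟩
    have : y ^ 2 / (x ^ 2 + y ^ 2) ≤ 1 / 2 := by
      rw [div_le_div_iff₀ hpos two_pos]; linarith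
    simp only [Pi.one_apply]
    linarith
  · rw [indicator_of_notMem hx]
    simp only
    linarith

theorem tendsto_mul_shift {F : ℂ → ℂ} (hlim : Tendsto (fun z => z * F z)
    (cobounded ℂ ⊓ 𝓟 {z | 0 < z.im}) (𝓝 1)) {ε : ℝ} (hε : 0 < ε) :
    Tendsto (fun z => z * F (z + ε * I)) (cobounded ℂ ⊓ 𝓟 {z | 0 ≤ z.im}) (𝓝 1) := by
  have hs : Tendsto (fun z : ℂ => z + ε * I) (cobounded ℂ ⊓ 𝓟 {z | 0 ≤ z.im})
      (cobounded ℂ ⊓ 𝓟 {z | 0 < z.im}) := by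
    refine tendsto_inf.2 ⟨(tendsto_add_const_cobounded _).mono_left inf_le_left,
      tendsto_inf_right (tendsto_principal_principal.2 fun z hz => ?_)⟩
    rw [mem_ofPred_eq] at hz ⊢
    rw [add_im, im_ofReal_mul_I]
    linarith
  have h1 := hlim.comp hs
  have h2 : Tendsto (fun z : ℂ => z⁻¹) (cobounded ℂ ⊓ 𝓟 {z | 0 < z.im}) (𝓝 0) :=
    tendsto_inv₀_cobounded.mono_left inf_le_left
  have h3 := ((hlim.mul h2).comp hs).const_mul (ε * I)
  have h4 := h1.sub h3
  simp only [mul_zero, sub_zero] at h4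
  refine h4.congr' ?_
  have hne : ∀ᶠ z : ℂ in cobounded ℂ ⊓ 𝓟 {z | 0 ≤ z.im}, z + ε * I ≠ 0 :=
    hs.eventually ((eventually_ne_cobounded (0 : ℂ)).filter_mono inf_le_left)
  filter_upwards [hne] with z hz
  simp only [Function.comp_apply]
  field_simp
  ring

/-- Nevanlinna representation: a holomorphic function from the upper half-plane to the closed
lower one with `z F(z) → 1` at infinity is the Cauchy transform of a probability measure. The
measures of the shifts `F(· + iε)`, `0 < ε ≤ 1`, are tight, and a weak limit as `ε → 0` represents
`F`. -/
theorem exists_eq_cauchyTransform {F : ℂ → ℂ}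
    (hd : DifferentiableOn ℂ F {z | 0 < z.im})
    (him : ∀ z : ℂ, 0 < z.im → (F z).im ≤ 0)
    (hlim : Tendsto (fun z => z * F z) (cobounded ℂ ⊓ 𝓟 {z | 0 < z.im}) (𝓝 1)) :
    ∃ μ : ProbabilityMeasure ℝ, ∀ z : ℂ, 0 < z.im → F z = cauchyTransform μ z := by
  have hε : ∀ n : ℕ, (0 : ℝ) < 1 / ((n : ℝ) + 1) := fun n => by positivity
  have hstep : ∀ n : ℕ, ∃ μ : ProbabilityMeasure ℝ, ∀ z : ℂ, 0 < z.im →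
      F (z + ((1 / ((n : ℝ) + 1) : ℝ) : ℂ) * I) = cauchyTransform μ z := by
    intro n
    have hshift : DifferentiableOn ℂ (fun z => F (z + ((1 / ((n : ℝ) + 1) : ℝ) : ℂ) * I))
        {z | 0 ≤ z.im} := by
      refine hd.comp (differentiableOn_id.add_const _) fun z hz => ?_
      rw [mem_ofPred_eq] at hz ⊢
      rw [add_im, im_ofReal_mul_I]
      linarith [hε n]
    refine exists_eq_cauchyTransform_of_continuousOn hshift.continuousOn
      (hshift.mono fun z (hz : 0 < z.im) => hz.le) (fun x => him _ ?_) (tendsto_mul_shift hlim (hε n))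
    rw [add_im, im_ofReal_mul_I, ofReal_im, zero_add]
    exact hε n
  choose μ hμ using hstep
  have htight : IsTightMeasureSet {((ν : ProbabilityMeasure ℝ) : Measure ℝ) | ν ∈ range μ} := by
    rw [isTightMeasureSet_iff_exists_isCompact_measure_compl_le]
    intro η hη
    obtain ⟨c, hc0, hcη⟩ := ENNReal.lt_iff_exists_nnreal_btwn.1 hη
    have hc0' : 0 < (c : ℝ) := by exact_mod_cast hc0
    -- A tail of at most `2 (1 - (1 - δ)²) ≤ 4 δ ≤ c`, uniformly in the shift.
    set δ : ℝ := min (c / 4) 1 with hδ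
    have hδ0 : 0 < δ := lt_min (by positivity) one_pos
    have hδ1 : δ ≤ 1 := min_le_right _ _
    have hδc : 4 * δ ≤ c := by
      have := min_le_left ((c : ℝ) / 4) 1
      rw [← hδ] at this; linarith
    have hre := (continuous_re.tendsto _).comp
      (hlim.comp (tendsto_I_mul_cobounded fun z hz => hz))
    have hev : ∀ᶠ y : ℝ in atTop, 1 - δ < ((y : ℂ) * I * F ((y : ℂ) * I)).re :=
      hre.eventually (lt_mem_nhds (by simpa using hδ0))
    obtain ⟨Y, hY⟩ := eventually_atTop.1 hev
    set y : ℝ := max Y δ⁻¹ with hy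
    have hyδ : δ⁻¹ ≤ y := le_max_right _ _
    have hy0 : 0 < y := lt_of_lt_of_le (by positivity) hyδ
    refine ⟨Icc (-y) y, isCompact_Icc, ?_⟩
    rintro _ ⟨_, ⟨n, rfl⟩, rfl⟩
    have hb := measureReal_compl_Icc_le (μ n : Measure ℝ) hy0
    rw [← hμ n _ (by simpa using hy0)] at hb
    set ε : ℝ := 1 / ((n : ℝ) + 1) with hεd
    have hε0 : 0 < ε := hε n
    have hε1 : ε ≤ 1 := by
      rw [hεd, div_le_one (by positivity)]
      linarith [(Nat.cast_nonneg n : (0 : ℝ) ≤ n)]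
    have h1 := hY (y + ε) ((le_max_left _ _).trans (by linarith))
    have h2 : (y : ℂ) * I * F ((y : ℂ) * I + ε * I)
        = ((y / (y + ε) : ℝ) : ℂ) * (((y + ε : ℝ) : ℂ) * I * F (((y + ε : ℝ) : ℂ) * I)) := by
      have hne : ((y : ℂ) + ε) ≠ 0 := by
        rw [← ofReal_add]; exact ofReal_ne_zero.2 (by positivity)
      push_cast
      rw [add_mul]
      field_simp
    rw [h2, re_ofReal_mul] at hb
    have h3 : 1 - δ ≤ y / (y + ε) := by
      rw [le_div_iff₀ (by positivity)]
      have : 1 ≤ δ * y := by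
        rw [inv_le_iff_one_le_mul₀ hδ0] at hyδ
        linarith
      nlinarith
    have h4 : (1 - δ) * (1 - δ) ≤
        y / (y + ε) * (((y + ε : ℝ) : ℂ) * I * F (((y + ε : ℝ) : ℂ) * I)).re :=
      mul_le_mul h3 h1.le (by linarith) (by positivity)
    have h5 : (μ n : Measure ℝ).real (Icc (-y) y)ᶜ ≤ c := by nlinarith
    refine le_trans ?_ hcη.le
    rw [← ENNReal.ofReal_coe_nnreal]
    rwa [← ofReal_measureReal, ENNReal.ofReal_le_ofReal_iff hc0'.le]
  have hcpt := isCompact_closure_of_isTightMeasureSet htight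
  -- A limit along an ultrafilter finer than `atTop` replaces the choice of a subsequence.
  obtain ⟨ν, -, hν⟩ := hcpt.ultrafilter_le_nhds ((Ultrafilter.of (atTop : Filter ℕ)).map μ) (by
    rw [le_principal_iff, Ultrafilter.mem_coe, Ultrafilter.mem_map]
    exact univ_mem' fun n => subset_closure (mem_range_self n))
  have hν' : Tendsto μ (Ultrafilter.of (atTop : Filter ℕ)) (𝓝 ν) := hν
  refine ⟨ν, fun z hz => ?_⟩
  rw [ProbabilityMeasure.tendsto_iff_forall_integral_rclike_tendsto ℂ] at hν'
  have hconv := hν' (BoundedContinuousFunction.ofNormedAddCommGroup _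
    (continuous_one_div_sub hz) _ (norm_one_div_sub_le hz))
  simp only [BoundedContinuousFunction.coe_ofNormedAddCommGroup] at hconv
  refine tendsto_nhds_unique ?_ hconv
  refine Tendsto.congr (f₁ := fun n : ℕ => F (z + ((1 / ((n : ℝ) + 1) : ℝ) : ℂ) * I))
    (fun n => hμ n z hz) ?_
  refine Tendsto.mono_left ?_ (Ultrafilter.of_le atTop)
  have hopen : IsOpen {z : ℂ | 0 < z.im} := isOpen_lt continuous_const continuous_im
  have hFc : ContinuousAt F z := (hd.differentiableAt (hopen.mem_nhds hz)).continuousAt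
  refine hFc.tendsto.comp ?_
  have h0 : Tendsto (fun n : ℕ => ((1 / ((n : ℝ) + 1) : ℝ) : ℂ)) atTop (𝓝 ((0 : ℝ) : ℂ)) :=
    (continuous_ofReal.tendsto 0).comp tendsto_one_div_add_atTop_nhds_zero_nat
  simpa using (h0.mul_const I).const_add z

/-! ### The argument of `1 - (1 - u) ^ t` -/

theorem mul_sin_le_sin_mul {t φ : ℝ} (ht0 : 0 ≤ t) (ht1 : t ≤ 1) (h0 : 0 ≤ φ)
    (hπ : φ ≤ Real.pi) : t * Real.sin φ ≤ Real.sin (t * φ) := by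
  have h := strictConcaveOn_sin_Icc.concaveOn.2 (x := 0) (y := φ) ⟨le_rfl, Real.pi_pos.le⟩ ⟨h0, hπ⟩
    (sub_nonneg.2 ht1) ht0 (by ring)
  simpa using h

/-- The concavity of `sin` gives `sin (t φ) ≥ t sin φ` and `sin ((1 - t) φ) ≥ (1 - t) sin φ`, and
weighted AM-GM gives `t + (1 - t) ρ ≥ ρ ^ (1 - t)`. -/
theorem rpow_mul_sin_le {t φ ρ : ℝ} (ht0 : 0 ≤ t) (ht1 : t ≤ 1) (h0 : 0 ≤ φ)
    (hπ : φ ≤ Real.pi) (hρ : 0 ≤ ρ) :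
    ρ ^ (1 - t) * Real.sin φ ≤ Real.sin (t * φ) + ρ * Real.sin ((1 - t) * φ) := by
  have h1 := mul_sin_le_sin_mul ht0 ht1 h0 hπ
  have h2 := mul_sin_le_sin_mul (sub_nonneg.2 ht1) (by linarith) h0 hπ
  have h3 := Real.geom_mean_le_arith_mean2_weighted ht0 (sub_nonneg.2 ht1) zero_le_one hρ (by ring)
  rw [Real.one_rpow, one_mul, mul_one] at h3
  have hs := Real.sin_nonneg_of_nonneg_of_le_pi h0 hπ
  calc ρ ^ (1 - t) * Real.sin φ ≤ (t + (1 - t) * ρ) * Real.sin φ := by gcongr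
    _ = t * Real.sin φ + ρ * ((1 - t) * Real.sin φ) := by ring
    _ ≤ _ := by gcongr

/-- The quotient `(1 - (1 - u) ^ t) / u`, by which `u ↦ 1 - (1 - u) ^ t` turns and scales `u`;
only `u ≠ 0` matters. -/
noncomputable def powQuot (t : ℝ) (u : ℂ) : ℂ := (1 - powTwo (1 - u) t) / u

theorem neg_pi_lt_arg_lt_zero {w : ℂ} (hw : w.im < 0) : -Real.pi < w.arg ∧ w.arg < 0 :=
  ⟨neg_pi_lt_arg w, arg_neg_iff.2 hw⟩

theorem arg_mem_Ioo {w : ℂ} (hw : 0 < w.im) : w.arg ∈ Ioo 0 Real.pi := by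
  refine ⟨(arg_nonneg_iff.2 hw.le).lt_of_ne fun h => ?_, (arg_le_pi w).lt_of_ne fun h => ?_⟩
  · exact hw.ne' (arg_eq_zero_iff.1 h.symm).2
  · exact hw.ne' (arg_eq_pi_iff.1 h).2

theorem powTwo_im_neg {t : ℝ} (ht0 : 0 < t) (ht1 : t ≤ 1) {w : ℂ} (hw : w.im < 0) :
    (powTwo w t).im < 0 := by
  obtain ⟨h1, h2⟩ := neg_pi_lt_arg_lt_zero hw
  rw [powTwo, exp_im, re_ofReal_mul, im_ofReal_mul, log_im]
  refine mul_neg_of_pos_of_neg (Real.exp_pos _) (Real.sin_neg_of_neg_of_neg_pi_lt ?_ ?_)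
  · exact mul_neg_of_pos_of_neg ht0 h2
  · nlinarith

/-- On the upper half-plane `u ↦ 1 - (1 - u) ^ t` does not decrease the argument. In polar
coordinates of `1 - u` this is `rpow_mul_sin_le`. -/
theorem powQuot_im_nonneg {t : ℝ} (ht0 : 0 < t) (ht1 : t ≤ 1) {u : ℂ} (hu : 0 < u.im) :
    0 ≤ (powQuot t u).im := by
  set w := 1 - u with hw
  have hwim : w.im < 0 := by simpa [hw] using hu
  have hw0 : w ≠ 0 := fun h => by simp [h] at hwim
  obtain ⟨h1, h2⟩ := neg_pi_lt_arg_lt_zero hwim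
  have hsin := rpow_mul_sin_le ht0.le ht1 (neg_nonneg.2 h2.le) (by linarith) (norm_nonneg w)
  have hnorm : 0 < ‖w‖ := norm_pos_iff.2 hw0
  -- Multiplying by `‖w‖ ^ t` gives `Im ((1 - w ^ t) conj (1 - w)) ≥ 0` after expansion.
  have hmul := mul_le_mul_of_nonneg_left hsin (Real.rpow_nonneg hnorm.le t)
  rw [← mul_assoc, ← Real.rpow_add hnorm, add_sub_cancel, Real.rpow_one] at hmul
  have hpre : (powTwo w t).re = ‖w‖ ^ t * Real.cos (t * w.arg) := by
    rw [powTwo, exp_re, re_ofReal_mul, im_ofReal_mul, log_im, log_re,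
      Real.rpow_def_of_pos hnorm, mul_comm t]
  have hpim : (powTwo w t).im = ‖w‖ ^ t * Real.sin (t * w.arg) := by
    rw [powTwo, exp_im, re_ofReal_mul, im_ofReal_mul, log_im, log_re,
      Real.rpow_def_of_pos hnorm, mul_comm t]
  have hwre : w.re = ‖w‖ * Real.cos w.arg := (norm_mul_cos_arg w).symm
  have hwim' : w.im = ‖w‖ * Real.sin w.arg := (norm_mul_sin_arg w).symm
  have hu' : u = 1 - w := by rw [hw]; ring
  have hsplit : Real.sin ((1 - t) * -w.arg) =
      -(Real.sin w.arg * Real.cos (t * w.arg) - Real.cos w.arg * Real.sin (t * w.arg)) := by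
    rw [← Real.sin_sub, ← Real.sin_neg]; congr 1; ring
  rw [hsplit, mul_neg t, Real.sin_neg, Real.sin_neg] at hmul
  have hnum : 0 ≤ ((1 - powTwo w t) * conj u).im := by
    rw [hu', mul_im, conj_re, conj_im]
    simp only [sub_re, sub_im, one_re, one_im]
    rw [hpre, hpim, hwre, hwim']
    nlinarith
  rw [powQuot, ← hw, div_eq_mul_inv, inv_def, ← mul_assoc, im_mul_ofReal]
  exact mul_nonneg hnum (inv_nonneg.2 (normSq_nonneg _))

theorem mul_powQuot {t : ℝ} {u : ℂ} (hu : u ≠ 0) :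
    u * powQuot t u = 1 - powTwo (1 - u) t := by
  rw [powQuot, mul_div_cancel₀ _ hu]

theorem arg_powQuot_of_im_pos {t : ℝ} (ht0 : 0 < t) (ht1 : t ≤ 1) {u : ℂ} (hu : 0 < u.im) :
    powQuot t u ≠ 0 ∧ 0 ≤ (powQuot t u).arg ∧ u.arg + (powQuot t u).arg < Real.pi := by
  have hu0 : u ≠ 0 := fun h => by simp [h] at hu
  have hv : 0 < (u * powQuot t u).im := by
    have h := powTwo_im_neg ht0 ht1 (w := 1 - u) (by simpa using hu)
    rw [mul_powQuot hu0, sub_im, one_im]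
    linarith
  have hq0 : powQuot t u ≠ 0 := fun h => by simp [h] at hv
  have harg := arg_nonneg_iff.2 (powQuot_im_nonneg ht0 ht1 hu)
  refine ⟨hq0, harg, ?_⟩
  obtain ⟨h1, h2⟩ := arg_mem_Ioo hu
  have h3 := arg_le_pi (powQuot t u)
  by_contra! hcon
  have hsin : Real.sin (u.arg + (powQuot t u).arg) ≤ 0 := by
    rw [← neg_nonneg, ← Real.sin_sub_pi]
    exact Real.sin_nonneg_of_nonneg_of_le_pi (by linarith) (by linarith)
  have him : (u * powQuot t u).im =
      ‖u‖ * ‖powQuot t u‖ * Real.sin (u.arg + (powQuot t u).arg) := by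
    rw [Real.sin_add, mul_im]
    linear_combination -(powQuot t u).im * norm_mul_cos_arg u
      - ‖u‖ * Real.cos u.arg * norm_mul_sin_arg (powQuot t u)
      - (powQuot t u).re * norm_mul_sin_arg u
      - ‖u‖ * Real.sin u.arg * norm_mul_cos_arg (powQuot t u)
  rw [him] at hv
  exact absurd hv (not_lt.2 (mul_nonpos_of_nonneg_of_nonpos (by positivity) hsin))

theorem powQuot_conj (t : ℝ) {u : ℂ} (hu : u.im ≠ 0) :
    powQuot t (conj u) = conj (powQuot t u) := by
  have h : (1 - u).arg ≠ Real.pi := fun h => hu (by simpa using (arg_eq_pi_iff.1 h).2)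
  rw [powQuot, powQuot, powTwo, powTwo, map_div₀, map_sub, map_one, ← exp_conj, map_mul,
    conj_ofReal, ← log_conj _ h, map_sub, map_one]

theorem arg_powQuot_of_neg {t : ℝ} (ht0 : 0 < t) {x : ℝ} (hx : x < 0) :
    powQuot t x ≠ 0 ∧ (powQuot t x).arg = 0 := by
  have h1 : powTwo (1 - (x : ℂ)) t = (((1 - x) ^ t : ℝ) : ℂ) := by
    have : (1 : ℂ) - x = ((1 - x : ℝ) : ℂ) := by push_cast; ring
    rw [powTwo, this, ← ofReal_log (by linarith), Real.rpow_def_of_pos (by linarith)]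
    push_cast
    rw [mul_comm]
  have h2 : powQuot t x = (((1 - (1 - x) ^ t) / x : ℝ) : ℂ) := by
    rw [powQuot, h1]; push_cast; ring
  have h3 : 0 < (1 - (1 - x) ^ t) / x :=
    div_pos_of_neg_of_neg (sub_neg.2 (Real.one_lt_rpow (by linarith) ht0)) hx
  rw [h2]
  exact ⟨ofReal_ne_zero.2 h3.ne', arg_ofReal_of_nonneg h3.le⟩

/-! ### The logarithm with imaginary part in `(0, 2π)` -/

theorem logOne_eq_of_exp_eq {z W : ℂ} (h : exp W = z) (h0 : 0 < W.im)
    (h2 : W.im < 2 * Real.pi) : logOne z = W := by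
  have h3 : -z = exp (W - Real.pi * I) := by
    rw [exp_sub, exp_pi_mul_I, h]; ring
  rw [logOne, h3, log_exp]
  · ring
  · simp; linarith
  · simp; linarith

theorem exp_mem_cutPlane {W : ℂ} (h0 : 0 < W.im) (h2 : W.im < 2 * Real.pi) :
    exp W ∈ cutPlane := by
  rcases lt_trichotomy W.im Real.pi with h | h | h
  · refine Or.inr (ne_of_gt ?_)
    rw [exp_im]
    exact mul_pos (Real.exp_pos _) (Real.sin_pos_of_pos_of_lt_pi h0 h)
  · refine Or.inl ?_
    rw [exp_re, h, Real.cos_pi]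
    linarith [Real.exp_pos W.re]
  · refine Or.inr (ne_of_lt ?_)
    rw [exp_im, ← neg_neg (Real.sin _), ← Real.sin_sub_pi]
    exact mul_neg_of_pos_of_neg (Real.exp_pos _)
      (neg_neg_of_pos (Real.sin_pos_of_pos_of_lt_pi (by linarith) (by linarith)))

/-! ### Sectors preserved by `u ↦ 1 - (1 - u) ^ t` -/

/-- The map `u ↦ 1 - (1 - u) ^ t` moves the argument `θ ∈ (0, 2π)` of `u` towards `π`: the new
argument lies between `θ` and `π`, and on the same side of `π` as `θ`. -/
theorem arg_powQuot_exp {t : ℝ} (ht0 : 0 < t) (ht1 : t ≤ 1) {W : ℂ} (h0 : 0 < W.im)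
    (h2 : W.im < 2 * Real.pi) :
    powQuot t (exp W) ≠ 0 ∧
    (W.im < Real.pi ∧ W.im ≤ W.im + (powQuot t (exp W)).arg ∧
        W.im + (powQuot t (exp W)).arg < Real.pi ∨
      W.im = Real.pi ∧ (powQuot t (exp W)).arg = 0 ∨
      Real.pi < W.im ∧ Real.pi < W.im + (powQuot t (exp W)).arg ∧
        W.im + (powQuot t (exp W)).arg ≤ W.im) := by
  have hup : ∀ W' : ℂ, 0 < W'.im → W'.im < Real.pi →
      powQuot t (exp W') ≠ 0 ∧ 0 ≤ (powQuot t (exp W')).arg ∧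
        W'.im + (powQuot t (exp W')).arg < Real.pi := by
    intro W' h h'
    have him : 0 < (exp W').im := by
      rw [exp_im]
      exact mul_pos (Real.exp_pos _) (Real.sin_pos_of_pos_of_lt_pi h h')
    have harg : (exp W').arg = W'.im := by
      rw [← log_im, log_exp (by linarith) h'.le]
    have := arg_powQuot_of_im_pos ht0 ht1 him
    rwa [harg] at this
  rcases lt_trichotomy W.im Real.pi with h | h | h
  · obtain ⟨h3, h4, h5⟩ := hup W h0 h
    exact ⟨h3, Or.inl ⟨h, by linarith, h5⟩⟩
  · have he : exp W = ((-Real.exp W.re : ℝ) : ℂ) := by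
      apply Complex.ext
      · rw [exp_re, h, Real.cos_pi, ofReal_re]; ring
      · rw [exp_im, h, Real.sin_pi, ofReal_im, mul_zero]
    obtain ⟨h3, h4⟩ := arg_powQuot_of_neg ht0 (neg_neg_of_pos (Real.exp_pos W.re))
    rw [he]
    exact ⟨h3, Or.inr (Or.inl ⟨h, h4⟩)⟩
  · have him : (exp W).im ≠ 0 := by
      rw [exp_im, ← neg_neg (Real.sin _), ← Real.sin_sub_pi]
      exact (mul_neg_of_pos_of_neg (Real.exp_pos _)
        (neg_neg_of_pos (Real.sin_pos_of_pos_of_lt_pi (by linarith) (by linarith)))).ne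
    -- Reflection in the real axis reduces to arguments in `(0, π)`.
    have he : exp (conj W + 2 * Real.pi * I) = conj (exp W) := by
      rw [exp_add, exp_two_pi_mul_I, mul_one, exp_conj]
    have hi : (conj W + 2 * Real.pi * I).im = 2 * Real.pi - W.im := by
      simp; ring
    have h3 := hup (conj W + 2 * Real.pi * I) (by rw [hi]; linarith) (by rw [hi]; linarith)
    rw [he, hi, powQuot_conj t him, arg_conj] at h3
    obtain ⟨h4, h5, h6⟩ := h3
    refine ⟨fun h => h4 (by rw [h, map_zero]), Or.inr (Or.inr ⟨h, ?_⟩)⟩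
    split_ifs at h5 h6 with hc
    · linarith
    · exact ⟨by linarith, by linarith⟩

/-- Both cases of admissibility say that the sector `arg s ≤ θ ≤ arg s + α π` contains `π` and is
contained in `[0, 2π]`. -/
theorem Admissible.sector {α : ℝ} {s : ℂ} (h : Admissible α s) :
    0 < α ∧ α ≤ 2 ∧ 0 ≤ s.arg ∧ s.arg ≤ Real.pi ∧ Real.pi ≤ s.arg + α * Real.pi ∧
      s.arg + α * Real.pi ≤ 2 * Real.pi := by
  have hpi := Real.pi_pos
  rcases h with ⟨h1, h2, h3, h4⟩ | ⟨h1, h2, h3, h4⟩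
  · exact ⟨h1, by linarith, by nlinarith, h4, by linarith, by nlinarith⟩
  · exact ⟨by linarith, h2, h3, by nlinarith, by nlinarith, by linarith⟩

theorem logOne_eq_log {w : ℂ} (hw : 0 < w.im) : logOne w = log w := by
  obtain ⟨h1, h2⟩ := arg_mem_Ioo hw
  exact logOne_eq_of_exp_eq (exp_log fun h => by simp [h] at hw) (by rwa [log_im])
    (by rw [log_im]; linarith)

theorem neg_one_div_im_pos {z : ℂ} (hz : 0 < z.im) : 0 < (-1 / z).im := by
  have : 0 < normSq z := normSq_pos.2 fun h => by simp [h] at hz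
  rw [neg_div, one_div, neg_im, inv_im]
  rw [neg_div, neg_neg]
  positivity

theorem logOne_neg_one_div_im {z : ℂ} (hz : 0 < z.im) :
    (logOne (-1 / z)).im ∈ Ioo 0 Real.pi := by
  have h := neg_one_div_im_pos hz
  rw [logOne_eq_log h, log_im]
  exact arg_mem_Ioo h

theorem exp_log_add_mul_logOne {α : ℝ} {s : ℂ} (hs : s ≠ 0) (w : ℂ) :
    exp (log s + α * logOne w) = s * powOne w α := by
  rw [exp_add, exp_log hs, powOne]

theorem log_add_mul_logOne_im {α : ℝ} {s z : ℂ} (hadm : Admissible α s) (hz : 0 < z.im) :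
    s.arg < (log s + α * logOne (-1 / z)).im ∧
      (log s + α * logOne (-1 / z)).im < s.arg + α * Real.pi := by
  obtain ⟨h1, h2⟩ := logOne_neg_one_div_im hz
  have hα := hadm.sector.1
  rw [add_im, log_im, im_ofReal_mul]
  constructor
  · have := mul_pos hα h1
    linarith
  · have := mul_lt_mul_of_pos_left h2 hα
    linarith

/-- With `u = s (-1/z) ^ α`, the argument of `(1 - (1 - u) ^ t) / s` stays in `(0, α π)`: that of
`u` lies in the sector `(arg s, arg s + α π)`, whose closure contains `π`, and it moves
towards `π`. -/
theorem im_add_log_powQuot_mem_Ioo {α t : ℝ} {s z : ℂ} (ht0 : 0 < t) (ht1 : t ≤ 1)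
    (hs : s ≠ 0) (hadm : Admissible α s) (hz : 0 < z.im) :
    powQuot t (s * powOne (-1 / z) α) ≠ 0 ∧
      (α * logOne (-1 / z) + log (powQuot t (s * powOne (-1 / z) α))).im ∈
        Ioo 0 (α * Real.pi) := by
  obtain ⟨hα, -, hs0, hsπ, hsα, hs2⟩ := hadm.sector
  obtain ⟨hU1, hU2⟩ := log_add_mul_logOne_im hadm hz
  have h := arg_powQuot_exp ht0 ht1 (W := log s + α * logOne (-1 / z)) (by linarith) (by linarith)
  rw [exp_log_add_mul_logOne hs] at h
  obtain ⟨hq, h⟩ := h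
  refine ⟨hq, ?_⟩
  obtain ⟨h1, h2⟩ := logOne_neg_one_div_im hz
  rw [add_im, log_im, im_ofReal_mul] at *
  rcases h with ⟨_, _, _⟩ | ⟨_, _⟩ | ⟨_, _, _⟩ <;> constructor <;> linarith

/-! ### Properties of `G` -/

theorem mul_powOne_mem_cutPlane {α : ℝ} {s z : ℂ} (hs : s ≠ 0) (hadm : Admissible α s)
    (hz : 0 < z.im) : s * powOne (-1 / z) α ∈ cutPlane := by
  obtain ⟨-, -, hs0, -, -, hs2⟩ := hadm.sector
  obtain ⟨h1, h2⟩ := log_add_mul_logOne_im hadm hz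
  rw [← exp_log_add_mul_logOne hs]
  exact exp_mem_cutPlane (by linarith) (by linarith)

theorem innerFun_mem_slitPlane {α : ℝ} {s z : ℂ} (hs : s ≠ 0) (hadm : Admissible α s)
    (hz : 0 < z.im) : innerFun α s z ∈ slitPlane := by
  rw [innerFun, mem_slitPlane_iff]
  rcases mul_powOne_mem_cutPlane hs hadm hz with h | h
  · left; rw [sub_re, one_re]; linarith
  · right; rw [sub_im, one_im, zero_sub]; exact neg_ne_zero.2 h

theorem outerFun_eq_exp {α r : ℝ} {s z : ℂ} (hr : 1 ≤ r) (hs : s ≠ 0) (hadm : Admissible α s)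
    (hz : 0 < z.im) : outerFun α r s z =
      exp (α * logOne (-1 / z) + log (powQuot (1 / r) (s * powOne (-1 / z) α))) := by
  obtain ⟨hq, -⟩ := im_add_log_powQuot_mem_Ioo (t := 1 / r) (by positivity)
    ((div_le_one (by linarith)).2 hr) hs hadm hz
  have hw : powOne (-1 / z) α ≠ 0 := exp_ne_zero _
  rw [exp_add, exp_log hq, outerFun, innerFun, ← mul_powQuot (mul_ne_zero hs hw), mul_assoc,
    mul_div_cancel_left₀ _ hs, powOne]

theorem outerFun_mem_cutPlane {α r : ℝ} {s z : ℂ} (hr : 1 ≤ r) (hs : s ≠ 0)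
    (hadm : Admissible α s) (hz : 0 < z.im) : outerFun α r s z ∈ cutPlane := by
  have h := (im_add_log_powQuot_mem_Ioo (t := 1 / r) (by positivity)
    ((div_le_one (by linarith)).2 hr) hs hadm hz).2
  rw [outerFun_eq_exp hr hs hadm hz]
  exact exp_mem_cutPlane h.1 (h.2.trans_le (by nlinarith [hadm.sector.2.1, Real.pi_pos]))

theorem logOne_outerFun {α r : ℝ} {s z : ℂ} (hr : 1 ≤ r) (hs : s ≠ 0) (hadm : Admissible α s)
    (hz : 0 < z.im) : logOne (outerFun α r s z) =
      α * logOne (-1 / z) + log (powQuot (1 / r) (s * powOne (-1 / z) α)) := by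
  have h := (im_add_log_powQuot_mem_Ioo (t := 1 / r) (by positivity)
    ((div_le_one (by linarith)).2 hr) hs hadm hz).2
  exact logOne_eq_of_exp_eq (outerFun_eq_exp hr hs hadm hz).symm h.1
    (h.2.trans_le (by nlinarith [hadm.sector.2.1, Real.pi_pos]))

theorem logOne_outerFun_im_mem {α r : ℝ} {s z : ℂ} (hr : 1 ≤ r) (hs : s ≠ 0)
    (hadm : Admissible α s) (hz : 0 < z.im) :
    (logOne (outerFun α r s z)).im ∈ Ioo 0 (α * Real.pi) := by
  rw [logOne_outerFun hr hs hadm hz]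
  exact (im_add_log_powQuot_mem_Ioo (t := 1 / r) (by positivity)
    ((div_le_one (by linarith)).2 hr) hs hadm hz).2

theorem differentiableAt_powOne {w : ℂ} (hw : w ∈ cutPlane) (a : ℝ) :
    DifferentiableAt ℂ (fun w => powOne w a) w := by
  have h : -w ∈ slitPlane := by
    rw [mem_slitPlane_iff, neg_re, neg_im]
    exact hw.imp (fun h => by linarith) neg_ne_zero.2
  unfold powOne logOne
  exact (((differentiableAt_id.neg.clog h).add_const _).const_mul _).cexp

theorem differentiableAt_powTwo {w : ℂ} (hw : w ∈ slitPlane) (a : ℝ) :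
    DifferentiableAt ℂ (fun w => powTwo w a) w :=
  ((differentiableAt_id.clog hw).const_mul _).cexp

theorem differentiableOn_G {α r : ℝ} {s : ℂ} (hr : 1 ≤ r) (hs : s ≠ 0)
    (hadm : Admissible α s) : DifferentiableOn ℂ (G α r s) {z | 0 < z.im} := by
  intro z hz
  refine DifferentiableAt.differentiableWithinAt ?_
  have hz' : 0 < z.im := hz
  have hz0 : z ≠ 0 := fun h => by simp [h] at hz'
  have h1 : DifferentiableAt ℂ (fun z : ℂ => -1 / z) z :=
    (differentiableAt_const _).div differentiableAt_id hz0
  have h2 : DifferentiableAt ℂ (innerFun α s) z :=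
    (((differentiableAt_powOne (Or.inr (neg_one_div_im_pos hz').ne') α).comp z h1).const_mul
      s).const_sub 1
  have h3 : DifferentiableAt ℂ (outerFun α r s) z :=
    (((differentiableAt_powTwo (innerFun_mem_slitPlane hs hadm hz') (1 / r)).comp z h2).const_sub
      1).div_const s
  exact ((differentiableAt_powOne (outerFun_mem_cutPlane hr hs hadm hz') (1 / α)).comp z
    h3).const_mul _

theorem G_im_neg {α r : ℝ} {s z : ℂ} (hr : 1 ≤ r) (hs : s ≠ 0) (hadm : Admissible α s)
    (hz : 0 < z.im) : (G α r s z).im < 0 := by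
  obtain ⟨h1, h2⟩ := logOne_outerFun_im_mem hr hs hadm hz
  have hα := hadm.sector.1
  have hr0 : 0 < r ^ (1 / α) := Real.rpow_pos_of_pos (by linarith) _
  rw [G, ← ofReal_neg, im_ofReal_mul, powOne, exp_im, im_ofReal_mul]
  refine mul_neg_of_neg_of_pos (neg_neg_of_pos hr0) (mul_pos (Real.exp_pos _)
    (Real.sin_pos_of_pos_of_lt_pi (by positivity) ?_))
  rw [one_div, inv_mul_lt_iff₀ hα]
  exact h2

/-- The map `w ↦ exp (a w)` with `a > 0` is injective on every open horizontal strip of height at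
most `2π / a`. -/
theorem exp_ofReal_mul_injOn {a b : ℝ} (ha : 0 < a) {c : ℝ} (h : a * (c - b) ≤ 2 * Real.pi) :
    InjOn (fun w : ℂ => exp (a * w)) {w | w.im ∈ Ioo b c} := by
  intro w hw w' hw' he
  obtain ⟨n, hn⟩ := exp_eq_exp_iff_exists_int.1 he
  have him := congrArg Complex.im hn
  have e : ((n : ℂ) * (2 * Real.pi * I)).im = n * (2 * Real.pi) := by simp
  rw [add_im, e, im_ofReal_mul, im_ofReal_mul] at him
  have hlt1 : a * (w.im - w'.im) < a * (c - b) :=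
    mul_lt_mul_of_pos_left (by linarith [hw.2, hw'.1]) ha
  have hlt2 : a * (w'.im - w.im) < a * (c - b) :=
    mul_lt_mul_of_pos_left (by linarith [hw.1, hw'.2]) ha
  have hpi := Real.pi_pos
  have hn1 : (n : ℝ) < 1 := by
    by_contra! hc
    nlinarith
  have hn2 : (-1 : ℝ) < n := by
    by_contra! hc
    nlinarith
  have hn0 : n = 0 := by
    have h1 : n < 1 := by exact_mod_cast hn1
    have h2 : -1 < n := by exact_mod_cast hn2
    omega
  rw [hn0, Int.cast_zero, zero_mul, add_zero] at hn
  exact mul_left_cancel₀ (ofReal_ne_zero.2 ha.ne') hn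

/-- Each exponential in the formula for `G` is injective on the strip where its argument lies. -/
theorem injOn_G {α r : ℝ} {s : ℂ} (hr : 1 ≤ r) (hs : s ≠ 0) (hadm : Admissible α s) :
    InjOn (G α r s) {z | 0 < z.im} := by
  intro z hz z' hz' he
  have hz0 : 0 < z.im := hz
  have hz0' : 0 < z'.im := hz'
  have hα := hadm.sector.1
  have hr0 : ((r ^ (1 / α) : ℝ) : ℂ) ≠ 0 :=
    ofReal_ne_zero.2 (Real.rpow_pos_of_pos (by linarith) _).ne'
  have hne : ∀ w : ℂ, w ∈ cutPlane → w ≠ 0 := by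
    rintro w hw rfl
    simp [cutPlane] at hw
  have h1 : powOne (outerFun α r s z) (1 / α) = powOne (outerFun α r s z') (1 / α) :=
    mul_left_cancel₀ (neg_ne_zero.2 hr0) he
  have h2 : logOne (outerFun α r s z) = logOne (outerFun α r s z') :=
    exp_ofReal_mul_injOn (a := 1 / α) (b := 0) (c := α * Real.pi) (by positivity)
      (by rw [sub_zero, one_div, inv_mul_cancel_left₀ hα.ne']; linarith [Real.pi_pos])
      (logOne_outerFun_im_mem hr hs hadm hz0) (logOne_outerFun_im_mem hr hs hadm hz0') h1
  have h3 : outerFun α r s z = outerFun α r s z' := by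
    rw [← exp_logOne (hne _ (outerFun_mem_cutPlane hr hs hadm hz0)), h2,
      exp_logOne (hne _ (outerFun_mem_cutPlane hr hs hadm hz0'))]
  have h4 : powTwo (innerFun α s z) (1 / r) = powTwo (innerFun α s z') (1 / r) := by
    unfold outerFun at h3
    exact sub_right_injective ((div_left_inj' hs).1 h3)
  have him : ∀ {z : ℂ}, 0 < z.im →
      (log (innerFun α s z)).im ∈ Ioo (-Real.pi) Real.pi := fun {z} hz => by
    rw [log_im]
    exact ⟨neg_pi_lt_arg _, (arg_le_pi _).lt_of_ne
      (mem_slitPlane_iff_arg.1 (innerFun_mem_slitPlane hs hadm hz)).1⟩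
  have hr1 : 1 / r ≤ 1 := (div_le_one (by linarith)).2 hr
  have h5 : log (innerFun α s z) = log (innerFun α s z') :=
    exp_ofReal_mul_injOn (a := 1 / r) (b := -Real.pi) (c := Real.pi) (by positivity)
      (by nlinarith [Real.pi_pos]) (him hz0) (him hz0') h4
  have h6 : innerFun α s z = innerFun α s z' := by
    rw [← exp_log (slitPlane_ne_zero (innerFun_mem_slitPlane hs hadm hz0)), h5,
      exp_log (slitPlane_ne_zero (innerFun_mem_slitPlane hs hadm hz0'))]
  have h7 : powOne (-1 / z) α = powOne (-1 / z') α :=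
    mul_left_cancel₀ hs (sub_right_injective h6)
  have h8 : logOne (-1 / z) = logOne (-1 / z') :=
    exp_ofReal_mul_injOn (a := α) (b := 0) (c := Real.pi) hα
      (by nlinarith [Real.pi_pos, hadm.sector.2.1]) (logOne_neg_one_div_im hz0)
      (logOne_neg_one_div_im hz0') h7
  have h9 : -1 / z = -1 / z' := by
    rw [← exp_logOne (hne _ (Or.inr (neg_one_div_im_pos hz0).ne')), h8,
      exp_logOne (hne _ (Or.inr (neg_one_div_im_pos hz0').ne'))]
  rwa [div_eq_mul_inv, div_eq_mul_inv, mul_right_inj' (by norm_num), inv_inj] at h9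

/-- The limit is the derivative of `u ↦ 1 - (1 - u) ^ t` at zero. -/
theorem tendsto_powQuot (t : ℝ) : Tendsto (powQuot t) (𝓝[≠] 0) (𝓝 t) := by
  have h1 : HasDerivAt (fun u : ℂ => 1 - powTwo (1 - u) t) t 0 := by
    have h := (((((hasDerivAt_id (0 : ℂ)).const_sub 1).clog (by simp)).const_mul
      (t : ℂ)).cexp).const_sub 1
    simpa [powTwo] using h
  rw [hasDerivAt_iff_tendsto_slope] at h1
  refine h1.congr fun u => ?_
  simp [slope_def_field, powQuot, powTwo]

theorem norm_powOne {w : ℂ} (hw : w ≠ 0) (a : ℝ) : ‖powOne w a‖ = ‖w‖ ^ a := by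
  rw [powOne, norm_exp, re_ofReal_mul, logOne, add_re, log_re, norm_neg, re_ofReal_mul, I_re,
    mul_zero, add_zero, Real.rpow_def_of_pos (norm_pos_iff.2 hw), mul_comm]

theorem tendsto_powOne_neg_one_div {α : ℝ} (hα : 0 < α) :
    Tendsto (fun z : ℂ => powOne (-1 / z) α) (cobounded ℂ) (𝓝 0) := by
  rw [tendsto_zero_iff_norm_tendsto_zero]
  have h1 : Tendsto (fun z : ℂ => ‖z⁻¹‖ ^ α) (cobounded ℂ) (𝓝 (0 ^ α)) :=
    (tendsto_zero_iff_norm_tendsto_zero.1 tendsto_inv₀_cobounded).rpow_const (Or.inr hα.le)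
  rw [Real.zero_rpow hα.ne'] at h1
  refine h1.congr' ?_
  filter_upwards [eventually_ne_cobounded (0 : ℂ)] with z hz
  rw [norm_powOne (div_ne_zero (by norm_num) hz), neg_div, norm_neg, one_div]

/-- The factor `-1/z` splits off `G`, because `logOne` of `outerFun` is `α log (-1/z)` plus the
principal logarithm of `powQuot`. -/
theorem mul_G_eq {α r : ℝ} {s z : ℂ} (hr : 1 ≤ r) (hs : s ≠ 0) (hadm : Admissible α s)
    (hz : 0 < z.im) : z * G α r s z = ((r ^ (1 / α) : ℝ) : ℂ) *
      exp (log (powQuot (1 / r) (s * powOne (-1 / z) α)) / α) := by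
  have hz0 : z ≠ 0 := fun h => by simp [h] at hz
  have hα : (α : ℂ) ≠ 0 := ofReal_ne_zero.2 hadm.sector.1.ne'
  have h : ((1 / α : ℝ) : ℂ) *
      (α * logOne (-1 / z) + log (powQuot (1 / r) (s * powOne (-1 / z) α))) =
      logOne (-1 / z) + log (powQuot (1 / r) (s * powOne (-1 / z) α)) / α := by
    push_cast
    field_simp
  rw [G, powOne, logOne_outerFun hr hs hadm hz, h, exp_add,
    exp_logOne (div_ne_zero (by norm_num) hz0)]
  field_simp

theorem tendsto_mul_G {α r : ℝ} {s : ℂ} (hr : 1 ≤ r) (hs : s ≠ 0) (hadm : Admissible α s) :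
    Tendsto (fun z => z * G α r s z) (cobounded ℂ ⊓ 𝓟 {z | 0 < z.im}) (𝓝 1) := by
  have hr0 : 0 < r := by linarith
  have h1 : Tendsto (fun z : ℂ => s * powOne (-1 / z) α) (cobounded ℂ) (𝓝[≠] 0) := by
    refine tendsto_nhdsWithin_iff.2 ⟨?_, Eventually.of_forall fun z =>
      mul_ne_zero hs (exp_ne_zero _)⟩
    simpa using (tendsto_powOne_neg_one_div hadm.sector.1).const_mul s
  have h2 := (((tendsto_powQuot (1 / r)).comp h1).clog
    (Or.inl (by rw [ofReal_re]; positivity))).div_const (α : ℂ)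
  have h3 := (((continuous_exp.tendsto _).comp h2).const_mul
    (((r ^ (1 / α) : ℝ) : ℂ))).mono_left (inf_le_left (b := 𝓟 {z : ℂ | 0 < z.im}))
  have h4 : ((r ^ (1 / α) : ℝ) : ℂ) * exp (log ((1 / r : ℝ) : ℂ) / α) = 1 := by
    rw [← ofReal_log (by positivity), ← ofReal_div, ← ofReal_exp, ← ofReal_mul,
      Real.rpow_def_of_pos hr0, ← Real.exp_add, one_div r, Real.log_inv]
    simp [div_eq_mul_inv]
  rw [h4] at h3
  refine h3.congr' ?_
  filter_upwards [mem_inf_of_right (mem_principal_self _)] with z hz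
  exact (mul_G_eq hr hs hadm hz).symm

end CauchyPowers

theorem theorem3p2 (r α : ℝ) (s : ℂ) (hr : 1 ≤ r) (hs : s ≠ 0)
    (hadm : CauchyPowers.Admissible α s) :
    (∀ z ∈ UpperHalfPlane.upperHalfPlaneSet, CauchyPowers.WellDefinedAt α r s z) ∧
    (∃ μ : MeasureTheory.Measure ℝ, MeasureTheory.IsProbabilityMeasure μ ∧
      ∀ z ∈ UpperHalfPlane.upperHalfPlaneSet,
        CauchyPowers.G α r s z = CauchyPowers.cauchyTransform μ z) ∧
    CauchyPowers.UnivalentOn (CauchyPowers.G α r s) UpperHalfPlane.upperHalfPlaneSet := by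
  have hdiff := CauchyPowers.differentiableOn_G hr hs hadm
  refine ⟨fun z hz => ⟨Or.inr (CauchyPowers.neg_one_div_im_pos hz).ne',
    CauchyPowers.innerFun_mem_slitPlane hs hadm hz,
    CauchyPowers.outerFun_mem_cutPlane hr hs hadm hz⟩, ?_,
    hdiff, CauchyPowers.injOn_G hr hs hadm⟩
  obtain ⟨μ, hμ⟩ := CauchyPowers.exists_eq_cauchyTransform hdiff
    (fun z hz => (CauchyPowers.G_im_neg hr hs hadm hz).le)
    (CauchyPowers.tendsto_mul_G hr hs hadm)
  exact ⟨μ, μ.2, hμ⟩
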